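/- Consider the planar cubic system $$\dot x = xy-x^2y,\qquad \dot y = y^2+\tfrac14x^3+\tfrac14x^2+\tfrac14x+\tfrac14,$$ with first integral $H(x,y)=\frac1{16}x^{-2}(x-1)^2(x^2+2x+1+4y^2)$ and centre $(-1,0)$. For $h>0$ let $\Gamma_h=\{(x,y): x<0,\ H(x,y)=h\}$. Each $\Gamma_h$ is a closed orbit of the system surrounding $(-1,0)$; orient it by the flow. Let $n\ge 3$, let $a_0,\dots,a_n\in\mathbb R$, and put $$I(h)=\frac12\sum_{i=0}^n a_i\oint_{\Gamma_h}(x-1)x^{i-3}y\,dx,\qquad h\in(0,+\infty).$$ Let $$K(k)=\int_0^{\pi/2}\frac{d\theta}{\sqrt{1-k^2\sin^2\theta}},\qquad E(k)=\int_0^{\pi/2}\sqrt{1-k^2\sin^2\theta}\,d\theta$$ be the complete elliptic integrals of the first and second kind, and set $$u=\sqrt{8h+1-4\sqrt{4h^2+h}},\qquad k=\sqrt{1-u^4}.$$ Then $h\mapsto u$ is a bijection from $(0,+\infty)$ onto $(0,1)$, and, with $[\cdot]$ denoting the integer part, there are real polynomials $P,Q,R$ (depending only on $n$ and $a_0,\dots,a_n$)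 such that for all $h>0$: - if $n$ is odd, $$I(h)=\frac{1}{u^{2[\frac{n-3}{2}]+3}}\Big[u\,P(u^2)+Q(u)K(k)+R(u^2)E(k)\Big],$$ with $\deg P\le 2[\frac{n-2}2]+2$, $\deg Q\le 4[\frac{n-3}2]+6$, $\deg R\le 2[\frac{n-3}2]+2$; - if $n$ is even, $$I(h)=\frac{1}{u^{2[\frac{n-2}{2}]+2}}\Big[P(u^2)+Q(u)K(k)+u\,R(u^2)E(k)\Big],$$ with $\deg P\le 2[\frac{n-2}2]+2$, $\deg Q\le 4[\frac{n-3}2]+7$, $\deg R\le 2[\frac{n-3}2]+2$. -/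

import Mathlib

namespace CubicReversible

noncomputable section

/-- The unperturbed system `x' = x y - x² y`, `y' = y² + x³/4 + x²/4 + x/4 + 1/4`. -/
def vectorField (p : ℝ × ℝ) : ℝ × ℝ :=
  (p.1 * p.2 - p.1 ^ 2 * p.2,
    p.2 ^ 2 + (1 / 4) * p.1 ^ 3 + (1 / 4) * p.1 ^ 2 + (1 / 4) * p.1 + 1 / 4)

/-- The first integral `H(x, y) = (1/16) x⁻² (x - 1)² (x² + 2x + 1 + 4y²)`, used for `x < 0`. -/
def firstIntegral (p : ℝ × ℝ) : ℝ :=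
  (1 / 16) * (p.1 ^ 2)⁻¹ * (p.1 - 1) ^ 2 * (p.1 ^ 2 + 2 * p.1 + 1 + 4 * p.2 ^ 2)

/-- The oval `Γ_h` around the centre `(-1, 0)`. The level set of `H` at level `h` also has points
with `x > 0`, which do not surround the centre; the oval is its part in the half plane `x < 0`. -/
def oval (h : ℝ) : Set (ℝ × ℝ) :=
  {p | p.1 < 0 ∧ firstIntegral p = h}

/-- `γ` is a periodic solution of the unperturbed system, of period `T`, which runs through `Γ_h`
exactly once per period: a parametrization of the closed orbit `Γ_h`, oriented by the flow. -/
structure IsOrbitParam (h : ℝ) (γ : ℝ → ℝ × ℝ) (T : ℝ) : Prop where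
  period_pos : 0 < T
  solution : ∀ t, HasDerivAt γ (vectorField (γ t)) t
  periodic : Function.Periodic γ T
  bijOn : Set.BijOn γ (Set.Ico 0 T) (oval h)

/-- The line integral `∮ (x - 1) x^(i - 3) y^j dx` along the closed curve `γ` on `[0, T]`. -/
def lineIntegral (γ : ℝ → ℝ × ℝ) (T : ℝ) (i j : ℕ) : ℝ :=
  ∫ t in (0 : ℝ)..T,
    ((γ t).1 - 1) * (γ t).1 ^ ((i : ℤ) - 3) * (γ t).2 ^ j * deriv (fun s => (γ s).1) t

/-- The Abelian integral `(1/2) ∑_{i=0}^n a_i ∮ (x - 1) x^(i - 3) y dx` along `γ`. -/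
def abelianIntegral (n : ℕ) (a : ℕ → ℝ) (γ : ℝ → ℝ × ℝ) (T : ℝ) : ℝ :=
  (1 / 2) * ∑ i ∈ Finset.range (n + 1), a i * lineIntegral γ T i 1

/-- The complete elliptic integral of the first kind with modulus `k`. -/
def ellipticK (k : ℝ) : ℝ :=
  ∫ θ in (0 : ℝ)..(Real.pi / 2), 1 / √(1 - k ^ 2 * Real.sin θ ^ 2)

/-- The complete elliptic integral of the second kind with modulus `k`. -/
def ellipticE (k : ℝ) : ℝ :=
  ∫ θ in (0 : ℝ)..(Real.pi / 2), √(1 - k ^ 2 * Real.sin θ ^ 2)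

/-- The new variable `u` as a function of `h`. -/
def uVar (h : ℝ) : ℝ := √(8 * h + 1 - 4 * √(4 * h ^ 2 + h))

/-- The modulus `k = √(1 - u⁴)`. -/
def modulus (u : ℝ) : ℝ := √(1 - u ^ 4)

end

end CubicReversible

/-! In the coordinate `z = x⁻² + 2 i y (1 - x) x⁻²` of the half plane `x < 0` the system becomes
`z' = i (z - (8 H + 1))`. The ovals are therefore circles traversed with unit angular velocity, and
`u²`, `u⁻²` are the points where the circle meets the real axis, so that `x⁻² = c + r cos t` with
`c = (u⁻² + u²) / 2` and `r = (u⁻² - u²) / 2`. Integrating the derivative of `r sin t * x ^ i` over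
a period expresses the line integrals through the moments `∫ x ^ i dt`, and eliminating the moments
gives a three-term recurrence between the line integrals with indices `i`, `i + 2`, `i + 4`.
For even `i` the integrals are elementary, because `x²` is a Poisson kernel on a circle; for odd `i`
the substitution `t = 2 θ` turns the initial moments into `K(k)` and `E(k)`. Multiplying the `i`-th
integral by `u ^ i` makes the coefficients of the recurrence polynomials in `u⁴`, which gives the
degree bounds. -/

namespace CubicReversible

open Complex Polynomial
open scoped Real

/-! ### The ovals as circles -/

/-- The linearizing coordinate `x⁻² + 2 i y (1 - x) x⁻²` of the half plane `x < 0`, in which each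
oval is a circle traversed with unit angular velocity. -/
noncomputable def oscCoord (p : ℝ × ℝ) : ℂ :=
  ⟨(p.1 ^ 2)⁻¹, 2 * p.2 * (1 - p.1) / p.1 ^ 2⟩

/-- The inverse of `oscCoord` on the half plane `re z > 0`. -/
noncomputable def ofOscCoord (z : ℂ) : ℝ × ℝ :=
  (-(√z.re)⁻¹, z.im * (√z.re)⁻¹ ^ 2 / (2 * (1 + (√z.re)⁻¹)))

theorem oscCoord_ofOscCoord {z : ℂ} (hz : 0 < z.re) : oscCoord (ofOscCoord z) = z := by
  have := Real.sqrt_pos.2 hz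
  apply Complex.ext
  · rw [oscCoord, ofOscCoord, neg_sq, inv_pow, inv_inv, Real.sq_sqrt hz.le]
  · rw [oscCoord, ofOscCoord]
    field_simp
    ring

theorem ofOscCoord_oscCoord {p : ℝ × ℝ} (hp : p.1 < 0) : ofOscCoord (oscCoord p) = p := by
  have hsqrt : (√(oscCoord p).re)⁻¹ = -p.1 := by
    rw [oscCoord, Real.sqrt_inv, inv_inv, Real.sqrt_sq_eq_abs, abs_of_neg hp]
  have hx : 1 - p.1 ≠ 0 := by linarith
  ext
  · rw [ofOscCoord, hsqrt, neg_neg]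
  · have := hp.ne
    rw [ofOscCoord, hsqrt, ← sub_eq_add_neg, oscCoord]
    field_simp

theorem ofOscCoord_fst_neg {z : ℂ} (hz : 0 < z.re) : (ofOscCoord z).1 < 0 :=
  neg_neg_of_pos (inv_pos.2 (Real.sqrt_pos.2 hz))

theorem firstIntegral_eq_iff {p : ℝ × ℝ} (hp : p.1 ≠ 0) {h : ℝ} :
    firstIntegral p = h ↔ normSq (oscCoord p - ↑(8 * h + 1)) = (8 * h + 1) ^ 2 - 1 := by
  have key : normSq (oscCoord p - ↑(8 * h + 1)) - ((8 * h + 1) ^ 2 - 1) =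
      16 * (firstIntegral p - h) / p.1 ^ 2 := by
    rw [normSq_apply, sub_re, sub_im, ofReal_re, ofReal_im, oscCoord, firstIntegral]
    field_simp
    ring
  rw [← sub_eq_zero (b := _ - 1), key]
  simp [hp, sub_eq_zero]

theorem hasDerivAt_of_re_of_im {z : ℝ → ℂ} {z' : ℂ} {t : ℝ}
    (hre : HasDerivAt (fun s => (z s).re) z'.re t) (him : HasDerivAt (fun s => (z s).im) z'.im t) :
    HasDerivAt z z' t := by
  have h := hre.ofReal_comp.add (him.ofReal_comp.mul_const I)
  rw [re_add_im] at h
  exact h.congr_of_eventuallyEq (.of_forall fun s => (re_add_im (z s)).symm)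

theorem hasDerivAt_oscCoord {γ : ℝ → ℝ × ℝ} {t : ℝ} (hγ : HasDerivAt γ (vectorField (γ t)) t)
    (hx : (γ t).1 ≠ 0) :
    HasDerivAt (fun s => oscCoord (γ s))
      ((oscCoord (γ t) - ↑(8 * firstIntegral (γ t) + 1)) * I) t := by
  have hfst : HasDerivAt (fun s => (γ s).1) (vectorField (γ t)).1 t := hγ.fst
  have hsnd : HasDerivAt (fun s => (γ s).2) (vectorField (γ t)).2 t := hγ.snd
  have hsq := hfst.pow 2
  have hsq0 := pow_ne_zero 2 hx
  apply hasDerivAt_of_re_of_im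
  · refine (hsq.inv hsq0).congr_deriv ?_
    simp only [oscCoord, vectorField, Pi.pow_apply, Nat.cast_ofNat, Nat.add_one_sub_one, pow_one,
      mul_I_re, sub_im, ofReal_im]
    field_simp
    ring
  · refine (((hsnd.const_mul 2).mul (hfst.const_sub 1)).div hsq hsq0).congr_deriv ?_
    simp only [oscCoord, vectorField, firstIntegral, Pi.pow_apply, Pi.mul_apply, Nat.cast_ofNat,
      Nat.add_one_sub_one, pow_one, mul_I_im, sub_re, ofReal_re]
    field_simp
    ring

theorem hasDerivAt_ofOscCoord {z : ℝ → ℂ} {h t : ℝ}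
    (hz : HasDerivAt z ((z t - ↑(8 * h + 1)) * I) t) (hpos : 0 < (z t).re)
    (hnorm : normSq (z t - ↑(8 * h + 1)) = (8 * h + 1) ^ 2 - 1) :
    HasDerivAt (fun s => ofOscCoord (z s)) (vectorField (ofOscCoord (z t))) t := by
  have hre : HasDerivAt (fun s => (z s).re) (-(z t).im) t :=
    (reCLM.hasFDerivAt.comp_hasDerivAt t hz).congr_deriv (by simp)
  have him : HasDerivAt (fun s => (z s).im) ((z t).re - (8 * h + 1)) t :=
    (imCLM.hasFDerivAt.comp_hasDerivAt t hz).congr_deriv (by simp)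
  have hs := Real.sqrt_pos.2 hpos
  have hs' := inv_pos.2 hs
  have hinv := (hre.sqrt hpos.ne').inv hs.ne'
  have hden : 2 * (1 + (√(z t).re)⁻¹) ≠ 0 := by positivity
  have hy := (him.mul (hinv.pow 2)).div ((hinv.const_add 1).const_mul 2) hden
  refine (hinv.neg.prodMk hy).congr_deriv ?_
  have hr : (z t).re = √(z t).re ^ 2 := (Real.sq_sqrt hpos.le).symm
  rw [normSq_apply, sub_re, sub_im, ofReal_re, ofReal_im, sub_zero] at hnorm
  simp only [ofOscCoord, vectorField, Pi.pow_apply, Pi.mul_apply, Pi.inv_apply,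
    Nat.cast_ofNat, Nat.add_one_sub_one, pow_one]
  rw [hr] at hnorm ⊢
  rw [Real.sqrt_sq hs.le]
  generalize √(z t).re = s at *
  ext
  · field_simp
    ring
  · field_simp
    linear_combination 4 * (1 + s) * hnorm

/-! ### The orbits and their uniqueness -/

/-- The level of the oval that crosses the `x`-axis at `-u` and at `-u⁻¹`. -/
noncomputable def level (u : ℝ) : ℝ := firstIntegral (-u, 0)

/-- The centre of the circle corresponding to the oval at level `level u`. -/
noncomputable def centre (u : ℝ) : ℝ := ((u ^ 2)⁻¹ + u ^ 2) / 2

/-- The radius of the circle corresponding to the oval at level `level u`. -/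
noncomputable def radius (u : ℝ) : ℝ := ((u ^ 2)⁻¹ - u ^ 2) / 2

theorem eight_mul_level_add_one {u : ℝ} (hu : u ≠ 0) : 8 * level u + 1 = centre u := by
  rw [level, firstIntegral, centre]
  field_simp
  ring

theorem radius_sq {u : ℝ} (hu : u ≠ 0) : radius u ^ 2 = centre u ^ 2 - 1 := by
  rw [radius, centre]
  field_simp
  ring

theorem centre_sub_radius (u : ℝ) : centre u - radius u = u ^ 2 := by
  rw [radius, centre]
  ring

theorem radius_pos {u : ℝ} (hu : u ∈ Set.Ioo 0 1) : 0 < radius u := by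
  have h1 : u ^ 2 < 1 := pow_lt_one₀ hu.1.le hu.2 two_ne_zero
  have h2 : 1 < (u ^ 2)⁻¹ := (one_lt_inv₀ (pow_pos hu.1 2)).2 h1
  rw [radius]
  linarith

theorem re_pos_of_mem_sphere {u : ℝ} (hu : u ≠ 0) {z : ℂ}
    (hz : z ∈ Metric.sphere (centre u : ℂ) (radius u)) : 0 < z.re := by
  have h := neg_le_of_abs_le ((abs_re_le_norm _).trans_eq (mem_sphere_iff_norm.1 hz))
  rw [sub_re, ofReal_re] at h
  have := pow_pos (abs_pos.2 hu) 2
  rw [sq_abs, ← centre_sub_radius] at this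
  linarith

theorem mem_oval_level_iff {u : ℝ} (hu : u ∈ Set.Ioo 0 1) {p : ℝ × ℝ} :
    p ∈ oval (level u) ↔ p.1 < 0 ∧ oscCoord p ∈ Metric.sphere (centre u : ℂ) (radius u) := by
  refine and_congr_right fun hx => ?_
  rw [firstIntegral_eq_iff hx.ne, eight_mul_level_add_one hu.1.ne', ← radius_sq hu.1.ne',
    normSq_eq_norm_sq, mem_sphere_iff_norm,
    pow_left_inj₀ (norm_nonneg _) (radius_pos hu).le two_ne_zero]

theorem bijOn_ofOscCoord {u : ℝ} (hu : u ∈ Set.Ioo 0 1) :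
    Set.BijOn ofOscCoord (Metric.sphere (centre u : ℂ) (radius u)) (oval (level u)) := by
  have hpos {z : ℂ} := re_pos_of_mem_sphere (z := z) hu.1.ne'
  refine Set.InvOn.bijOn (f' := oscCoord) ⟨fun z hz => oscCoord_ofOscCoord (hpos hz),
    fun p hp => ofOscCoord_oscCoord hp.1⟩ (fun z hz => ?_) fun p hp => ?_
  · rw [mem_oval_level_iff hu, oscCoord_ofOscCoord (hpos hz)]
    exact ⟨ofOscCoord_fst_neg (hpos hz), hz⟩
  · exact ((mem_oval_level_iff hu).1 hp).2

theorem bijOn_circleMap (c : ℂ) {R : ℝ} (hR : 0 < R) :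
    Set.BijOn (circleMap c R) (Set.Ico 0 (2 * π)) (Metric.sphere c R) := by
  refine ⟨fun t _ => circleMap_mem_sphere c hR.le t,
    injOn_circleMap_of_abs_sub_le' hR.ne' (by simp), fun z hz => ?_⟩
  rw [← abs_of_pos hR, ← range_circleMap] at hz
  obtain ⟨t, rfl⟩ := hz
  obtain ⟨s, hs, e⟩ := (periodic_circleMap c R).exists_mem_Ico₀ Real.two_pi_pos t
  exact ⟨s, hs, e.symm⟩

/-- The solution running through the oval at level `level u`, starting at `t = 0` from the point
of the oval with the largest abscissa. -/
noncomputable def orbit (u t : ℝ) : ℝ × ℝ := ofOscCoord (circleMap (centre u) (radius u) t)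

theorem orbit_periodic (u : ℝ) : Function.Periodic (orbit u) (2 * π) :=
  fun t => congrArg ofOscCoord (periodic_circleMap _ _ t)

theorem isOrbitParam_orbit {u : ℝ} (hu : u ∈ Set.Ioo 0 1) :
    IsOrbitParam (level u) (orbit u) (2 * π) where
  period_pos := Real.two_pi_pos
  solution t := by
    have hmem := circleMap_mem_sphere (centre u : ℂ) (radius_pos hu).le t
    refine hasDerivAt_ofOscCoord (h := level u) ?_ (re_pos_of_mem_sphere hu.1.ne' hmem) ?_
    · rw [eight_mul_level_add_one hu.1.ne', circleMap_sub_center]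
      exact hasDerivAt_circleMap ..
    · rw [eight_mul_level_add_one hu.1.ne', normSq_eq_norm_sq, mem_sphere_iff_norm.1 hmem,
        radius_sq hu.1.ne']
  periodic := orbit_periodic u
  bijOn := (bijOn_ofOscCoord hu).comp (bijOn_circleMap _ (radius_pos hu))

theorem eq_circleMap_of_hasDerivAt {z : ℝ → ℂ} {c : ℂ} {R t₀ : ℝ}
    (hz : ∀ t, HasDerivAt z ((z t - c) * I) t) (h₀ : z 0 = circleMap c R t₀) (t : ℝ) :
    z t = circleMap c R (t + t₀) := by
  have hlip : LipschitzWith 1 fun w : ℂ => (w - c) * I :=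
    .of_dist_le_mul fun v w => by simp [dist_eq_norm, ← sub_mul]
  have hcircle (t : ℝ) : HasDerivAt (fun s => circleMap c R (s + t₀))
      ((circleMap c R (t + t₀) - c) * I) t := by
    rw [circleMap_sub_center]
    exact (hasDerivAt_circleMap c R (t + t₀)).comp_add_const t t₀
  exact congrFun (ODE_solution_unique_univ (fun _ => hlip.lipschitzOnWith (s := Set.univ))
    (fun t => ⟨hz t, trivial⟩) (fun t => ⟨hcircle t, trivial⟩) (t₀ := 0) (by rwa [zero_add])) t

theorem le_of_injOn_Ico {α : Type*} {f : ℝ → α} {S T : ℝ} (hf : Set.InjOn f (Set.Ico 0 T))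
    (hS : 0 < S) (h : f S = f 0) : T ≤ S := by
  by_contra! hST
  exact hS.ne' (hf ⟨hS.le, hST⟩ ⟨le_rfl, hS.trans hST⟩ h)

theorem IsOrbitParam.mem_oval {h : ℝ} {γ : ℝ → ℝ × ℝ} {T : ℝ} (H : IsOrbitParam h γ T) (t : ℝ) :
    γ t ∈ oval h := by
  obtain ⟨s, hs, e⟩ := H.periodic.exists_mem_Ico₀ H.period_pos t
  exact e ▸ H.bijOn.mapsTo hs

theorem IsOrbitParam.exists_eq_orbit_add {u : ℝ} (hu : u ∈ Set.Ioo 0 1) {γ : ℝ → ℝ × ℝ} {T : ℝ}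
    (H : IsOrbitParam (level u) γ T) : ∃ t₀, ∀ t, γ t = orbit u (t + t₀) := by
  obtain ⟨z₀, hz₀, e₀⟩ := (bijOn_ofOscCoord hu).surjOn (H.mem_oval 0)
  obtain ⟨t₀, -, rfl⟩ := (bijOn_circleMap _ (radius_pos hu)).surjOn hz₀
  have hosc (t : ℝ) : HasDerivAt (fun s => oscCoord (γ s)) ((oscCoord (γ t) - centre u) * I) t := by
    have h := hasDerivAt_oscCoord (H.solution t) (H.mem_oval t).1.ne
    rwa [(H.mem_oval t).2, eight_mul_level_add_one hu.1.ne'] at h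
  have hstart : oscCoord (γ 0) = circleMap (centre u) (radius u) t₀ := by
    rw [← e₀, oscCoord_ofOscCoord (re_pos_of_mem_sphere hu.1.ne' hz₀)]
  refine ⟨t₀, fun t => ?_⟩
  rw [orbit, ← eq_circleMap_of_hasDerivAt hosc hstart, ofOscCoord_oscCoord (H.mem_oval t).1]

theorem IsOrbitParam.period_eq {u : ℝ} (hu : u ∈ Set.Ioo 0 1) {γ : ℝ → ℝ × ℝ} {T : ℝ}
    (H : IsOrbitParam (level u) γ T) : T = 2 * π := by
  obtain ⟨t₀, hγ⟩ := H.exists_eq_orbit_add hu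
  apply le_antisymm
  · refine le_of_injOn_Ico H.bijOn.injOn Real.two_pi_pos ?_
    rw [hγ, hγ, zero_add, add_comm, orbit_periodic u]
  · refine le_of_injOn_Ico (isOrbitParam_orbit hu).bijOn.injOn H.period_pos ?_
    have h := H.periodic (-t₀)
    rwa [hγ, hγ, neg_add_cancel, neg_add_cancel_comm] at h

theorem IsOrbitParam.lineIntegral_eq {u : ℝ} (hu : u ∈ Set.Ioo 0 1) {γ : ℝ → ℝ × ℝ} {T : ℝ}
    (H : IsOrbitParam (level u) γ T) (i j : ℕ) :
    lineIntegral γ T i j = lineIntegral (orbit u) (2 * π) i j := by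
  obtain rfl := H.period_eq hu
  obtain ⟨t₀, hγ⟩ := H.exists_eq_orbit_add hu
  let F (t : ℝ) : ℝ := ((orbit u t).1 - 1) * (orbit u t).1 ^ ((i : ℤ) - 3) * (orbit u t).2 ^ j *
    deriv (fun s => (orbit u s).1) t
  have hF : Function.Periodic F (2 * π) := fun t => by
    simp only [F, orbit_periodic u t, ← deriv_comp_add_const (fun s => (orbit u s).1),
      orbit_periodic u _]
  calc lineIntegral γ (2 * π) i j = ∫ t in (0 : ℝ)..(2 * π), F (t + t₀) := by
        simp only [lineIntegral, hγ, F, deriv_comp_add_const (fun s => (orbit u s).1)]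
    _ = ∫ t in t₀..(t₀ + 2 * π), F t := by
        rw [intervalIntegral.integral_comp_add_right, zero_add, add_comm]
    _ = lineIntegral (orbit u) (2 * π) i j := by
        rw [hF.intervalIntegral_add_eq t₀ 0, zero_add]; rfl

theorem level_pos {u : ℝ} (hu : u ∈ Set.Ioo 0 1) : 0 < level u := by
  have hu0 := hu.1
  have hu1 := sub_ne_zero.2 hu.2.ne
  have hlevel : level u = (u - 1) ^ 2 * (u + 1) ^ 2 / (16 * u ^ 2) := by
    rw [level, firstIntegral]
    field_simp
    ring
  rw [hlevel]
  positivity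

theorem uVar_level {u : ℝ} (hu : u ∈ Set.Ioo 0 1) : uVar (level u) = u := by
  have hsqrt : 4 * √(4 * level u ^ 2 + level u) = radius u := by
    have := level_pos hu
    rw [← pow_left_inj₀ (by positivity) (radius_pos hu).le two_ne_zero, mul_pow,
      Real.sq_sqrt (by positivity), radius_sq hu.1.ne', ← eight_mul_level_add_one hu.1.ne']
    ring
  rw [uVar, hsqrt, eight_mul_level_add_one hu.1.ne', centre_sub_radius, Real.sqrt_sq hu.1.le]

theorem eight_mul_add_one_sub {h : ℝ} (hh : 0 ≤ h) :
    8 * h + 1 - 4 * √(4 * h ^ 2 + h) = (8 * h + 1 + 4 * √(4 * h ^ 2 + h))⁻¹ := by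
  have := Real.sq_sqrt (show 0 ≤ 4 * h ^ 2 + h by positivity)
  refine eq_inv_of_mul_eq_one_left ?_
  linear_combination -16 * this

theorem uVar_mem_Ioo {h : ℝ} (hh : 0 < h) : uVar h ∈ Set.Ioo 0 1 := by
  have : 0 < √(4 * h ^ 2 + h) := by positivity
  rw [uVar, eight_mul_add_one_sub hh.le]
  refine ⟨by positivity, (Real.sqrt_lt' one_pos).2 ?_⟩
  rw [one_pow]
  exact inv_lt_one_of_one_lt₀ (by linarith)

theorem level_uVar {h : ℝ} (hh : 0 < h) : level (uVar h) = h := by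
  have hsq : uVar h ^ 2 = 8 * h + 1 - 4 * √(4 * h ^ 2 + h) := by
    rw [uVar, Real.sq_sqrt]
    rw [eight_mul_add_one_sub hh.le]
    positivity
  have hcentre := eight_mul_level_add_one (uVar_mem_Ioo hh).1.ne'
  rw [centre, hsq, eight_mul_add_one_sub hh.le, inv_inv, ← eight_mul_add_one_sub hh.le] at hcentre
  linarith

theorem bijOn_uVar : Set.BijOn uVar (Set.Ioi 0) (Set.Ioo 0 1) :=
  Set.InvOn.bijOn ⟨fun _ => level_uVar, fun _ => uVar_level⟩ (fun _ => uVar_mem_Ioo)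
    fun _ => level_pos

/-! ### Moments of the abscissa -/

/-- The integral of the `i`-th power of the abscissa over one period of the orbit `orbit u`. -/
noncomputable def moment (u : ℝ) (i : ℤ) : ℝ := ∫ t in 0..2 * π, (orbit u t).1 ^ i

section Moments

variable {u : ℝ} (hu : u ∈ Set.Ioo 0 1)
include hu

theorem oscCoord_orbit (t : ℝ) : oscCoord (orbit u t) = circleMap (centre u) (radius u) t :=
  oscCoord_ofOscCoord <| re_pos_of_mem_sphere hu.1.ne' <|
    circleMap_mem_sphere _ (radius_pos hu).le t

theorem orbit_fst_neg (t : ℝ) : (orbit u t).1 < 0 :=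
  (IsOrbitParam.mem_oval (isOrbitParam_orbit hu) t).1

theorem inv_sq_orbit_fst (t : ℝ) :
    ((orbit u t).1 ^ 2)⁻¹ = centre u + radius u * Real.cos t :=
  (congrArg re (oscCoord_orbit hu t)).trans (by simp [circleMap])

theorem orbit_snd_eq (t : ℝ) :
    2 * (orbit u t).2 * (1 - (orbit u t).1) = radius u * Real.sin t * (orbit u t).1 ^ 2 := by
  have h : 2 * (orbit u t).2 * (1 - (orbit u t).1) / (orbit u t).1 ^ 2 = radius u * Real.sin t :=
    (congrArg im (oscCoord_orbit hu t)).trans (by simp [circleMap])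
  exact (div_eq_iff (pow_ne_zero 2 (orbit_fst_neg hu t).ne)).1 h

theorem hasDerivAt_orbit_fst (t : ℝ) :
    HasDerivAt (fun s => (orbit u s).1) (radius u * Real.sin t * (orbit u t).1 ^ 3 / 2) t := by
  have h : HasDerivAt (fun s => (orbit u s).1) (vectorField (orbit u t)).1 t :=
    ((isOrbitParam_orbit hu).solution t).fst
  refine h.congr_deriv ?_
  rw [vectorField]
  linear_combination (orbit u t).1 / 2 * orbit_snd_eq hu t

theorem continuous_orbit_fst_zpow (i : ℤ) : Continuous fun t => (orbit u t).1 ^ i :=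
  (continuous_iff_continuousAt.2 fun t => (hasDerivAt_orbit_fst hu t).continuousAt).zpow₀ i
    fun t => .inl (orbit_fst_neg hu t).ne

theorem intervalIntegrable_orbit_fst_zpow (i : ℤ) :
    IntervalIntegrable (fun t => (orbit u t).1 ^ i) MeasureTheory.volume 0 (2 * π) :=
  (continuous_orbit_fst_zpow hu i).intervalIntegrable _ _

theorem radius_mul_cos_mul_orbit_fst_zpow (i : ℤ) (t : ℝ) :
    radius u * Real.cos t * (orbit u t).1 ^ i =
      (orbit u t).1 ^ (i - 2) - centre u * (orbit u t).1 ^ i := by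
  have hx := (orbit_fst_neg hu t).ne
  rw [zpow_sub₀ hx, zpow_ofNat, div_eq_mul_inv, inv_sq_orbit_fst hu]
  ring

theorem radius_mul_sin_sq_mul_orbit_fst_zpow (i : ℤ) (t : ℝ) :
    (radius u * Real.sin t) ^ 2 * (orbit u t).1 ^ (i + 2) =
      2 * centre u * (orbit u t).1 ^ i - (orbit u t).1 ^ (i + 2) - (orbit u t).1 ^ (i - 2) := by
  have hx := (orbit_fst_neg hu t).ne
  have h := inv_sq_orbit_fst hu t
  have hsin : (radius u * Real.sin t) ^ 2 =
      2 * centre u * ((orbit u t).1 ^ 2)⁻¹ - 1 - ((orbit u t).1 ^ 2)⁻¹ ^ 2 := by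
    rw [h]
    linear_combination radius u ^ 2 * Real.sin_sq_add_cos_sq t + radius_sq hu.1.ne'
  rw [hsin, zpow_sub₀ hx, zpow_add₀ hx, zpow_ofNat]
  field_simp

theorem lineIntegral_orbit_eq (i : ℕ) :
    lineIntegral (orbit u) (2 * π) i 1 = -(1 / 4) *
      ∫ t in 0..2 * π, (radius u * Real.sin t) ^ 2 * (orbit u t).1 ^ ((i : ℤ) + 2) := by
  rw [← intervalIntegral.integral_const_mul, lineIntegral]
  refine intervalIntegral.integral_congr fun t _ => ?_
  have hx := (orbit_fst_neg hu t).ne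
  have hy := orbit_snd_eq hu t
  simp only [(hasDerivAt_orbit_fst hu t).deriv, zpow_sub₀ hx, zpow_add₀ hx, zpow_ofNat, pow_one]
  field_simp
  linear_combination -2 * (radius u * Real.sin t) * hy

theorem four_mul_lineIntegral_orbit (i : ℕ) :
    4 * lineIntegral (orbit u) (2 * π) i 1 =
      moment u (i + 2) + moment u (i - 2) - 2 * centre u * moment u i := by
  have hint := intervalIntegrable_orbit_fst_zpow hu
  simp only [lineIntegral_orbit_eq hu, radius_mul_sin_sq_mul_orbit_fst_zpow hu]
  rw [intervalIntegral.integral_sub (((hint _).const_mul _).sub (hint _)) (hint _),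
    intervalIntegral.integral_sub ((hint _).const_mul _) (hint _),
    intervalIntegral.integral_const_mul]
  simp only [moment]
  ring

theorem hasDerivAt_radius_mul_sin_mul_orbit_fst_zpow (i : ℤ) (t : ℝ) :
    HasDerivAt (fun s => radius u * Real.sin s * (orbit u s).1 ^ i)
      ((orbit u t).1 ^ (i - 2) - centre u * (orbit u t).1 ^ i +
        i / 2 * ((radius u * Real.sin t) ^ 2 * (orbit u t).1 ^ (i + 2))) t := by
  have hx := (orbit_fst_neg hu t).ne
  have hpow : HasDerivAt (fun s => (orbit u s).1 ^ i)
      (i * (orbit u t).1 ^ (i - 1) * (radius u * Real.sin t * (orbit u t).1 ^ 3 / 2)) t :=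
    HasDerivAt.comp (h₂ := (· ^ i)) t (hasDerivAt_zpow i _ (.inl hx)) (hasDerivAt_orbit_fst hu t)
  refine (((Real.hasDerivAt_sin t).const_mul (radius u)).mul hpow).congr_deriv ?_
  rw [← radius_mul_cos_mul_orbit_fst_zpow hu, zpow_add₀ hx, zpow_sub_one₀ hx, zpow_ofNat]
  field_simp

theorem two_mul_mul_lineIntegral_orbit (i : ℕ) :
    2 * i * lineIntegral (orbit u) (2 * π) i 1 = moment u (i - 2) - centre u * moment u i := by
  have hint := intervalIntegrable_orbit_fst_zpow hu
  have hint' : IntervalIntegrable (fun t => (radius u * Real.sin t) ^ 2 *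
      (orbit u t).1 ^ ((i : ℤ) + 2)) MeasureTheory.volume 0 (2 * π) :=
    (hint _).continuousOn_mul (by fun_prop)
  have hFTC := intervalIntegral.integral_eq_sub_of_hasDerivAt
    (fun t _ => hasDerivAt_radius_mul_sin_mul_orbit_fst_zpow hu i t)
    (((hint _).sub ((hint _).const_mul _)).add (hint'.const_mul _))
  rw [intervalIntegral.integral_add ((hint _).sub ((hint _).const_mul _)) (hint'.const_mul _),
    intervalIntegral.integral_sub (hint _) ((hint _).const_mul _),
    intervalIntegral.integral_const_mul, intervalIntegral.integral_const_mul,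
    Real.sin_two_pi, Real.sin_zero] at hFTC
  rw [lineIntegral_orbit_eq hu, moment, moment]
  push_cast at hFTC
  linear_combination -hFTC

theorem lineIntegral_orbit_add_four (i : ℕ) :
    (i + 4) * lineIntegral (orbit u) (2 * π) (i + 4) 1 =
      2 * (i + 1) * centre u * lineIntegral (orbit u) (2 * π) (i + 2) 1 +
        (2 - i) * lineIntegral (orbit u) (2 * π) i 1 := by
  have h₀ := two_mul_mul_lineIntegral_orbit hu i
  have h₀' := four_mul_lineIntegral_orbit hu i
  have h₂ := two_mul_mul_lineIntegral_orbit hu (i + 2)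
  have h₂' := four_mul_lineIntegral_orbit hu (i + 2)
  have h₄ := two_mul_mul_lineIntegral_orbit hu (i + 4)
  push_cast at *
  rw [show (i : ℤ) + 2 + 2 = i + 4 by ring, add_sub_cancel_right] at *
  rw [show (i : ℤ) + 4 - 2 = i + 2 by ring] at *
  linear_combination h₄ / 2 + (h₀ - h₀') / 2 + centre u / 2 * (h₂' - h₂) - centre u / 2 * h₂

end Moments

theorem integral_comp_cos {f : ℝ → ℝ} (hf : Continuous fun t => f (Real.cos t)) :
    ∫ t in 0..2 * π, f (Real.cos t) = 4 * ∫ θ in 0..π / 2, f (Real.cos (2 * θ)) := by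
  have hreflect : ∫ t in π..2 * π, f (Real.cos t) = ∫ t in 0..π, f (Real.cos t) := by
    have h := intervalIntegral.integral_comp_sub_left (a := π) (b := 2 * π)
      (fun t => f (Real.cos t)) (2 * π)
    simp only [Real.cos_two_pi_sub, sub_self] at h
    rw [h, two_mul, add_sub_cancel_right]
  have hscale : 2 * ∫ θ in 0..π / 2, f (Real.cos (2 * θ)) = ∫ t in 0..π, f (Real.cos t) := by
    rw [intervalIntegral.mul_integral_comp_mul_left (f := fun t => f (Real.cos t)), mul_zero,
      mul_div_cancel₀ π two_ne_zero]
  rw [← intervalIntegral.integral_add_adjacent_intervals (b := π)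
    (hf.intervalIntegrable _ _) (hf.intervalIntegrable _ _), hreflect, ← hscale]
  ring

theorem moment_zero (u : ℝ) : moment u 0 = 2 * π := by simp [moment]

section BaseMoments

variable {u : ℝ} (hu : u ∈ Set.Ioo 0 1)
include hu

theorem poissonKernel_circleMap (t : ℝ) :
    poissonKernel 0 (u ^ 2 - 1 : ℝ) (circleMap 0 (1 + u ^ 2) t) = (orbit u t).1 ^ 2 := by
  rw [← inv_inv ((orbit u t).1 ^ 2), inv_sq_orbit_fst hu, poissonKernel_def]
  have hu0 := hu.1.ne'
  have hnorm : ‖circleMap 0 (1 + u ^ 2) t - (u ^ 2 - 1 : ℝ)‖ ^ 2 =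
      4 * u ^ 2 * (centre u + radius u * Real.cos t) := by
    rw [← normSq_eq_norm_sq, normSq_apply, centre, radius]
    simp only [circleMap_zero, sub_re, sub_im, re_ofReal_mul, im_ofReal_mul, exp_ofReal_mul_I_re,
      exp_ofReal_mul_I_im, ofReal_re, ofReal_im]
    field_simp
    linear_combination 2 * (1 + u ^ 2) ^ 2 * Real.sin_sq_add_cos_sq t
  have hR : ‖circleMap 0 (1 + u ^ 2) t‖ ^ 2 = (1 + u ^ 2) ^ 2 := by
    rw [norm_circleMap_zero, sq_abs]
  have hw : ‖((u ^ 2 - 1 : ℝ) : ℂ)‖ ^ 2 = (u ^ 2 - 1) ^ 2 := by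
    rw [norm_real, Real.norm_eq_abs, sq_abs]
  rw [sub_zero, sub_zero, hnorm, hR, hw, show (1 + u ^ 2) ^ 2 - (u ^ 2 - 1) ^ 2 = 4 * u ^ 2 by ring,
    div_mul_cancel_left₀ (by positivity)]

theorem moment_two : moment u 2 = 2 * π := by
  have hw : ((u ^ 2 - 1 : ℝ) : ℂ) ∈ Metric.ball 0 (1 + u ^ 2) := by
    rw [mem_ball_zero_iff, norm_real, Real.norm_eq_abs, abs_lt]
    constructor <;> nlinarith [hu.1]
  have h := InnerProductSpace.HarmonicContOnCl.circleAverage_poissonKernel_smul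
    (InnerProductSpace.harmonicContOnCl_const (c := (1 : ℝ))) hw
  simp only [Real.circleAverage, Pi.smul_apply', poissonKernel_circleMap hu, smul_eq_mul,
    mul_one] at h
  rw [inv_mul_eq_one₀ (by positivity)] at h
  exact h.symm

theorem orbit_fst_eq (t : ℝ) :
    (orbit u t).1 = -(√(centre u + radius u * Real.cos t))⁻¹ := by
  rw [← inv_sq_orbit_fst hu, Real.sqrt_inv, inv_inv, Real.sqrt_sq_eq_abs,
    abs_of_neg (orbit_fst_neg hu t), neg_neg]

theorem sqrt_centre_add_radius_mul_cos_two_mul (θ : ℝ) :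
    √(centre u + radius u * Real.cos (2 * θ)) =
      √(1 - modulus u ^ 2 * Real.sin θ ^ 2) / u := by
  have hmod : modulus u ^ 2 = 1 - u ^ 4 :=
    Real.sq_sqrt (sub_nonneg.2 (pow_le_one₀ hu.1.le hu.2.le))
  rw [← Real.sqrt_sq hu.1.le, ← Real.sqrt_div' _ (sq_nonneg u), Real.sqrt_sq hu.1.le, hmod,
    Real.cos_two_mul', Real.cos_sq', centre, radius]
  have := hu.1.ne'
  congr 1
  field_simp
  ring

theorem moment_one : moment u 1 = -4 * u * ellipticK (modulus u) := by
  have hcont := continuous_orbit_fst_zpow hu 1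
  simp only [moment, zpow_one, orbit_fst_eq hu] at hcont ⊢
  rw [integral_comp_cos (f := fun c => -(√(centre u + radius u * c))⁻¹) hcont, ellipticK]
  simp only [sqrt_centre_add_radius_mul_cos_two_mul hu, inv_div, div_eq_mul_one_div u,
    intervalIntegral.integral_neg, intervalIntegral.integral_const_mul]
  ring

theorem moment_neg_one : moment u (-1) = -4 / u * ellipticE (modulus u) := by
  have hcont := continuous_orbit_fst_zpow hu (-1)
  simp only [moment, zpow_neg_one, orbit_fst_eq hu, inv_neg, inv_inv] at hcont ⊢
  rw [integral_comp_cos (f := fun c => -√(centre u + radius u * c)) hcont, ellipticE]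
  simp only [sqrt_centre_add_radius_mul_cos_two_mul hu, intervalIntegral.integral_neg,
    intervalIntegral.integral_div]
  ring

theorem moment_neg_two : moment u (-2) = 2 * π * centre u := by
  have h : 0 = moment u (-2) - centre u * moment u 0 := by
    simpa using two_mul_mul_lineIntegral_orbit hu 0
  rw [moment_zero] at h
  linear_combination -h

theorem moment_three : moment u 3 = moment u (-1) := by
  have h₁ : 4 * lineIntegral (orbit u) (2 * π) 1 1 =
      moment u 3 + moment u (-1) - 2 * centre u * moment u 1 := four_mul_lineIntegral_orbit hu 1
  have h₁' : 2 * lineIntegral (orbit u) (2 * π) 1 1 = moment u (-1) - centre u * moment u 1 := by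
    simpa using two_mul_mul_lineIntegral_orbit hu 1
  linear_combination 2 * h₁' - h₁

theorem lineIntegral_orbit_zero :
    lineIntegral (orbit u) (2 * π) 0 1 = π / 2 * (1 - centre u) := by
  have h : 4 * lineIntegral (orbit u) (2 * π) 0 1 =
      moment u 2 + moment u (-2) - 2 * centre u * moment u 0 := four_mul_lineIntegral_orbit hu 0
  rw [moment_zero, moment_two hu, moment_neg_two hu] at h
  linear_combination h / 4

theorem lineIntegral_orbit_two :
    lineIntegral (orbit u) (2 * π) 2 1 = π / 2 * (1 - centre u) := by
  have h : 2 * (2 : ℕ) * lineIntegral (orbit u) (2 * π) 2 1 =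
      moment u 0 - centre u * moment u 2 := two_mul_mul_lineIntegral_orbit hu 2
  rw [moment_zero, moment_two hu] at h
  linear_combination h / 4

theorem mul_lineIntegral_orbit_one :
    u * lineIntegral (orbit u) (2 * π) 1 1 =
      (1 + u ^ 4) * ellipticK (modulus u) - 2 * ellipticE (modulus u) := by
  have h : 2 * lineIntegral (orbit u) (2 * π) 1 1 = moment u (-1) - centre u * moment u 1 := by
    simpa using two_mul_mul_lineIntegral_orbit hu 1
  rw [moment_one hu, moment_neg_one hu, centre] at h
  have hu0 := hu.1.ne'
  field_simp at h
  linear_combination h / 4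

theorem pow_mul_lineIntegral_orbit_three :
    u ^ 3 * lineIntegral (orbit u) (2 * π) 3 1 =
      (1 + u ^ 4) / 3 * ellipticE (modulus u) - 2 / 3 * u ^ 4 * ellipticK (modulus u) := by
  have h : 2 * (3 : ℕ) * lineIntegral (orbit u) (2 * π) 3 1 =
      moment u 1 - centre u * moment u 3 := two_mul_mul_lineIntegral_orbit hu 3
  rw [moment_three hu, moment_one hu, moment_neg_one hu, centre] at h
  have hu0 := hu.1.ne'
  field_simp at h
  linear_combination h / 12

end BaseMoments

/-! ### Spaces of polynomial multiples -/

section PolyMultiples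

variable {R S : Type*} [CommSemiring R] [CommSemiring S] [Algebra R S]

/-- The module of all `P(v) * F` with `P` a polynomial over `R` of degree at most `d`: it records
the shape and the degree of a term like `P(u²) E(k)`. -/
noncomputable def polyMultiples (R : Type*) [CommSemiring R] [Algebra R S] (v F : S) (d : ℕ) :
    Submodule R S :=
  (degreeLE R d).map (LinearMap.mulRight R F ∘ₗ (aeval v).toLinearMap)

theorem mem_polyMultiples {v F x : S} {d : ℕ} :
    x ∈ polyMultiples R v F d ↔ ∃ P : R[X], P.natDegree ≤ d ∧ aeval v P * F = x := by
  simp [polyMultiples, mem_degreeLE, natDegree_le_iff_degree_le]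

theorem polyMultiples_mono (v F : S) {d e : ℕ} (h : d ≤ e) :
    polyMultiples R v F d ≤ polyMultiples R v F e :=
  Submodule.map_mono (degreeLE_mono (mod_cast h))

theorem pow_mul_mem_polyMultiples (v F : S) (k : ℕ) : v ^ k * F ∈ polyMultiples R v F k :=
  mem_polyMultiples.2 ⟨X ^ k, natDegree_X_pow_le k, by simp⟩

theorem self_mem_polyMultiples (v F : S) (d : ℕ) : F ∈ polyMultiples R v F d :=
  polyMultiples_mono v F d.zero_le <| by simpa using pow_mul_mem_polyMultiples (R := R) v F 0

theorem mul_mem_polyMultiples {v F G x y : S} {d e : ℕ} (hx : x ∈ polyMultiples R v F d)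
    (hy : y ∈ polyMultiples R v G e) : x * y ∈ polyMultiples R v (F * G) (d + e) := by
  obtain ⟨P, hP, rfl⟩ := mem_polyMultiples.1 hx
  obtain ⟨Q, hQ, rfl⟩ := mem_polyMultiples.1 hy
  exact mem_polyMultiples.2 ⟨P * Q, natDegree_mul_le.trans (add_le_add hP hQ), by
    rw [map_mul, mul_mul_mul_comm]⟩

theorem mul_self_mem_polyMultiples {v x : S} {d : ℕ} (hx : x ∈ polyMultiples R v 1 d) (F : S) :
    x * F ∈ polyMultiples R v F d := by
  simpa using mul_mem_polyMultiples hx (self_mem_polyMultiples v F 0)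

theorem polyMultiples_pow_le (v F : S) (k d : ℕ) :
    polyMultiples R (v ^ k) F d ≤ polyMultiples R v F (k * d) := by
  intro x hx
  obtain ⟨P, hP, rfl⟩ := mem_polyMultiples.1 hx
  refine mem_polyMultiples.2 ⟨expand R k P, ?_, by rw [expand_aeval]⟩
  rw [natDegree_expand, mul_comm]
  exact Nat.mul_le_mul_left k hP

theorem mul_mem_polyMultiples_of_mem_one {v F x y : S} {d e : ℕ}
    (hx : x ∈ polyMultiples R v 1 d) (hy : y ∈ polyMultiples R v F e) :
    x * y ∈ polyMultiples R v F (d + e) := by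
  simpa using mul_mem_polyMultiples hx hy

theorem pow_mul_mem_polyMultiples_of_mem {v F x : S} {d : ℕ} (k : ℕ)
    (hx : x ∈ polyMultiples R v F d) : v ^ k * x ∈ polyMultiples R v F (k + d) := by
  simpa using mul_mem_polyMultiples (pow_mul_mem_polyMultiples v 1 k) hx

theorem mul_mem_polyMultiples_sup {v F G x y : S} {d e k : ℕ} (hx : x ∈ polyMultiples R v 1 k)
    (hy : y ∈ polyMultiples R v F d ⊔ polyMultiples R v G e) :
    x * y ∈ polyMultiples R v F (k + d) ⊔ polyMultiples R v G (k + e) := by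
  obtain ⟨y₁, hy₁, y₂, hy₂, rfl⟩ := Submodule.mem_sup.1 hy
  rw [mul_add]
  exact Submodule.add_mem_sup (mul_mem_polyMultiples_of_mem_one hx hy₁)
    (mul_mem_polyMultiples_of_mem_one hx hy₂)

theorem pow_mul_mem_polyMultiples_sq {v F x : S} {d : ℕ} (k : ℕ)
    (hx : x ∈ polyMultiples R (v ^ 2) F d) :
    v ^ k * x ∈ polyMultiples R (v ^ 2) (v ^ (k % 2) * F) (k / 2 + d) := by
  have h : v ^ k = (v ^ 2) ^ (k / 2) * v ^ (k % 2) := by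
    rw [← pow_mul, ← pow_add, Nat.div_add_mod]
  exact h ▸ mul_mem_polyMultiples (pow_mul_mem_polyMultiples _ _ _) hx

end PolyMultiples

/-! ### Degrees in `u` -/

/-- The variable `u` as an element of the algebra of real functions on `(0, 1)`. -/
def uFun (u : Set.Ioo (0 : ℝ) 1) : ℝ := u

/-- The elliptic integral `K(k)` as a function of `u`. -/
noncomputable def ellipticKFun (u : Set.Ioo (0 : ℝ) 1) : ℝ := ellipticK (modulus u)

/-- The elliptic integral `E(k)` as a function of `u`. -/
noncomputable def ellipticEFun (u : Set.Ioo (0 : ℝ) 1) : ℝ := ellipticE (modulus u)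

/-- The `i`-th line integral over the orbit `orbit u`, multiplied by `u ^ i` in order to clear the
denominators `u`. -/
noncomputable def scaledIntegral (i : ℕ) (u : Set.Ioo (0 : ℝ) 1) : ℝ :=
  (u : ℝ) ^ i * lineIntegral (orbit u) (2 * π) i 1

theorem scaledIntegral_add_four (i : ℕ) :
    scaledIntegral (i + 4) =
      (((i + 1) / (i + 4) : ℝ) • ((1 + uFun ^ 4) * scaledIntegral (i + 2)) +
        ((2 - i) / (i + 4) : ℝ) • (uFun ^ 4 * scaledIntegral i)) := by
  funext u
  have hu := u.2.1.ne'
  have h := lineIntegral_orbit_add_four u.2 i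
  have hi : (i : ℝ) + 4 ≠ 0 := by positivity
  simp only [scaledIntegral, uFun, Pi.add_apply, Pi.smul_apply, Pi.mul_apply, Pi.pow_apply,
    Pi.one_apply, smul_eq_mul]
  rw [centre] at h
  field_simp at h ⊢
  linear_combination (u : ℝ) ^ (i + 2) * h

theorem scaledIntegral_two : scaledIntegral 2 = (-(π / 4)) • (1 - uFun ^ 2) ^ 2 := by
  funext u
  have hu := u.2.1.ne'
  simp only [scaledIntegral, uFun, Pi.smul_apply, Pi.sub_apply, Pi.pow_apply, Pi.one_apply,
    smul_eq_mul, lineIntegral_orbit_two u.2, centre]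
  field_simp
  ring

theorem scaledIntegral_four : scaledIntegral 4 = (-(π / 16)) • (1 - uFun ^ 4) ^ 2 := by
  funext u
  have hu := u.2.1.ne'
  have h := congrFun (scaledIntegral_add_four 0) u
  simp only [scaledIntegral, uFun, Pi.smul_apply, Pi.sub_apply, Pi.add_apply, Pi.mul_apply,
    Pi.pow_apply, Pi.one_apply, smul_eq_mul, lineIntegral_orbit_two u.2,
    lineIntegral_orbit_zero u.2, centre, zero_add, Nat.cast_zero] at h ⊢
  rw [h]
  field_simp
  ring

theorem scaledIntegral_one :
    scaledIntegral 1 = (1 + uFun ^ 4) * ellipticKFun - (2 : ℝ) • ellipticEFun := by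
  funext u
  simp only [scaledIntegral, pow_one, mul_lineIntegral_orbit_one u.2]
  rfl

theorem scaledIntegral_three :
    scaledIntegral 3 = (1 / 3 : ℝ) • ((1 + uFun ^ 4) * ellipticEFun) -
      (2 / 3 : ℝ) • (uFun ^ 4 * ellipticKFun) := by
  funext u
  simp only [scaledIntegral, pow_mul_lineIntegral_orbit_three u.2, Pi.sub_apply, Pi.smul_apply,
    Pi.mul_apply, Pi.add_apply, Pi.one_apply, Pi.pow_apply, smul_eq_mul, ellipticKFun,
    ellipticEFun, uFun]
  ring

theorem scaledIntegral_mem_of_mem {W : ℕ → Submodule ℝ (Set.Ioo (0 : ℝ) 1 → ℝ)} {i : ℕ}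
    (hadd : ∀ m, ∀ x ∈ W (m + 1), (1 + uFun ^ 4) * x ∈ W (m + 2))
    (hpow : ∀ m, ∀ x ∈ W m, uFun ^ 4 * x ∈ W (m + 2))
    (h₀ : scaledIntegral i ∈ W 0) (h₁ : scaledIntegral (i + 2) ∈ W 1) (m : ℕ) :
    scaledIntegral (i + 2 * m) ∈ W m := by
  induction m using Nat.twoStepInduction with
  | zero => exact h₀
  | one => exact h₁
  | more m ih ih' =>
    rw [show i + 2 * (m + 2) = i + 2 * m + 4 by ring, scaledIntegral_add_four]
    exact add_mem (Submodule.smul_mem _ _ (hadd m _ ih')) (Submodule.smul_mem _ _ (hpow m _ ih))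

theorem scaledIntegral_even_mem (m : ℕ) :
    scaledIntegral (2 + 2 * m) ∈ polyMultiples ℝ (uFun ^ 2) 1 (2 + 2 * m) := by
  have hpow (k : ℕ) : uFun ^ (2 * k) ∈ polyMultiples ℝ (uFun ^ 2) 1 k := by
    simpa [pow_mul] using pow_mul_mem_polyMultiples (R := ℝ) (uFun ^ 2) 1 k
  have hone (d : ℕ) : (1 : Set.Ioo (0 : ℝ) 1 → ℝ) ∈ polyMultiples ℝ (uFun ^ 2) 1 d :=
    self_mem_polyMultiples _ _ d
  have hsub (k : ℕ) : (1 - uFun ^ (2 * k)) ^ 2 ∈ polyMultiples ℝ (uFun ^ 2) 1 (k + k) := by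
    have h : 1 - uFun ^ (2 * k) ∈ polyMultiples ℝ (uFun ^ 2) 1 k := sub_mem (hone k) (hpow k)
    exact sq (1 - uFun ^ (2 * k)) ▸ mul_mem_polyMultiples_of_mem_one h h
  refine scaledIntegral_mem_of_mem (W := fun m => polyMultiples ℝ (uFun ^ 2) 1 (2 + 2 * m))
    (fun m x hx => ?_) (fun m x hx => ?_) ?_ ?_ m
  · exact polyMultiples_mono _ _ (by omega) <|
      mul_mem_polyMultiples_of_mem_one (add_mem (hone 2) (hpow 2)) hx
  · exact polyMultiples_mono _ _ (by omega) <| mul_mem_polyMultiples_of_mem_one (hpow 2) hx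
  · exact scaledIntegral_two ▸ Submodule.smul_mem _ _ (hsub 1)
  · exact scaledIntegral_four ▸ Submodule.smul_mem _ _ (hsub 2)

theorem scaledIntegral_odd_mem (m : ℕ) :
    scaledIntegral (1 + 2 * m) ∈
      polyMultiples ℝ (uFun ^ 4) ellipticEFun m ⊔
        polyMultiples ℝ (uFun ^ 4) ellipticKFun (max m 1) := by
  have hpow : uFun ^ 4 ∈ polyMultiples ℝ (uFun ^ 4) 1 1 := by
    simpa using pow_mul_mem_polyMultiples (R := ℝ) (uFun ^ 4) 1 1
  have hadd : 1 + uFun ^ 4 ∈ polyMultiples ℝ (uFun ^ 4) 1 1 :=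
    add_mem (self_mem_polyMultiples _ _ 1) hpow
  refine scaledIntegral_mem_of_mem (i := 1) (W := fun m =>
    polyMultiples ℝ (uFun ^ 4) ellipticEFun m ⊔ polyMultiples ℝ (uFun ^ 4) ellipticKFun (max m 1))
    (fun m x hx => ?_) (fun m x hx => ?_) ?_ ?_ m
  · exact sup_le_sup (polyMultiples_mono _ _ (by omega)) (polyMultiples_mono _ _ (by omega)) <|
      mul_mem_polyMultiples_sup hadd hx
  · exact sup_le_sup (polyMultiples_mono _ _ (by omega)) (polyMultiples_mono _ _ (by omega)) <|
      mul_mem_polyMultiples_sup hpow hx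
  · rw [scaledIntegral_one, Nat.zero_max]
    exact sub_mem (Submodule.mem_sup_right (mul_self_mem_polyMultiples hadd _))
      (Submodule.smul_mem _ _ (Submodule.mem_sup_left (self_mem_polyMultiples _ _ _)))
  · rw [scaledIntegral_three, max_self]
    exact sub_mem
      (Submodule.smul_mem _ _ (Submodule.mem_sup_left (mul_self_mem_polyMultiples hadd _)))
      (Submodule.smul_mem _ _ (Submodule.mem_sup_right (mul_self_mem_polyMultiples hpow _)))

/-- The functions of the form
`u ^ (n % 2) * P(u²) + Q(u) * K(k) + u ^ ((n + 1) % 2) * R(u²) * E(k)`, with the degrees of `P`,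
`Q`, `R` bounded as in the theorem; the two parities of `n` share these formulas. -/
noncomputable def ellipticForms (n : ℕ) : Submodule ℝ (Set.Ioo (0 : ℝ) 1 → ℝ) :=
  polyMultiples ℝ (uFun ^ 2) (uFun ^ (n % 2)) (2 * ((n - 2) / 2) + 2) ⊔
    polyMultiples ℝ uFun ellipticKFun (4 * ((n - 3) / 2) + 6 + (n + 1) % 2) ⊔
    polyMultiples ℝ (uFun ^ 2) (uFun ^ ((n + 1) % 2) * ellipticEFun) (2 * ((n - 3) / 2) + 2)

theorem pow_mul_scaledIntegral_even_mem {n m : ℕ} (h : 2 + 2 * m ≤ n) :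
    uFun ^ (n - (2 + 2 * m)) * scaledIntegral (2 + 2 * m) ∈ ellipticForms n := by
  have hmem := pow_mul_mem_polyMultiples_sq (n - (2 + 2 * m)) (scaledIntegral_even_mem m)
  rw [mul_one, show (n - (2 + 2 * m)) % 2 = n % 2 by omega] at hmem
  exact Submodule.mem_sup_left <| Submodule.mem_sup_left <|
    polyMultiples_mono _ _ (by omega) hmem

theorem pow_mul_scaledIntegral_odd_mem {n m : ℕ} (hn : 3 ≤ n) (h : 1 + 2 * m ≤ n) :
    uFun ^ (n - (1 + 2 * m)) * scaledIntegral (1 + 2 * m) ∈ ellipticForms n := by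
  obtain ⟨e, he, k, hk, hek⟩ := Submodule.mem_sup.1 (scaledIntegral_odd_mem m)
  rw [pow_mul uFun 2 2] at he
  replace he := pow_mul_mem_polyMultiples_sq (n - (1 + 2 * m)) (polyMultiples_pow_le _ _ _ _ he)
  rw [show (n - (1 + 2 * m)) % 2 = (n + 1) % 2 by omega] at he
  replace hk := pow_mul_mem_polyMultiples_of_mem (n - (1 + 2 * m)) (polyMultiples_pow_le _ _ _ _ hk)
  rw [← hek, mul_add, add_comm, ellipticForms, sup_assoc]
  refine Submodule.mem_sup_right <| Submodule.add_mem_sup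
    (polyMultiples_mono _ _ ?_ hk) (polyMultiples_mono _ _ ?_ he) <;> omega

theorem pow_mul_lineIntegral_orbit_mem {n i : ℕ} (hn : 3 ≤ n) (hi : i ≤ n) :
    (fun u : Set.Ioo (0 : ℝ) 1 => (u : ℝ) ^ n * lineIntegral (orbit u) (2 * π) i 1) ∈
      ellipticForms n := by
  have hscale {j : ℕ} (hj : j ≤ n) :
      (fun u : Set.Ioo (0 : ℝ) 1 => (u : ℝ) ^ n * lineIntegral (orbit u) (2 * π) j 1) =
        uFun ^ (n - j) * scaledIntegral j := by
    funext u
    rw [Pi.mul_apply, Pi.pow_apply, uFun, scaledIntegral, ← mul_assoc, pow_sub_mul_pow _ hj]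
  obtain rfl | hpos := i.eq_zero_or_pos
  · have h : ∀ u : Set.Ioo (0 : ℝ) 1, lineIntegral (orbit u) (2 * π) 0 1 =
        lineIntegral (orbit u) (2 * π) 2 1 := fun u => by
      rw [lineIntegral_orbit_zero u.2, lineIntegral_orbit_two u.2]
    simp only [h]
    rw [hscale (by omega)]
    exact pow_mul_scaledIntegral_even_mem (m := 0) (by omega)
  · rw [hscale hi]
    obtain ⟨m, rfl | rfl⟩ : ∃ m, i = 2 + 2 * m ∨ i = 1 + 2 * m := ⟨(i - 1) / 2, by omega⟩
    · exact pow_mul_scaledIntegral_even_mem hi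
    · exact pow_mul_scaledIntegral_odd_mem hn hi

theorem exists_polynomials_of_mem_ellipticForms {n : ℕ} {f : Set.Ioo (0 : ℝ) 1 → ℝ}
    (hf : f ∈ ellipticForms n) :
    ∃ P Q R : ℝ[X], P.natDegree ≤ 2 * ((n - 2) / 2) + 2 ∧
      Q.natDegree ≤ 4 * ((n - 3) / 2) + 6 + (n + 1) % 2 ∧
      R.natDegree ≤ 2 * ((n - 3) / 2) + 2 ∧
      ∀ u : Set.Ioo (0 : ℝ) 1, f u = (u : ℝ) ^ (n % 2) * P.eval ((u : ℝ) ^ 2) +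
        Q.eval (u : ℝ) * ellipticK (modulus u) +
        (u : ℝ) ^ ((n + 1) % 2) * R.eval ((u : ℝ) ^ 2) * ellipticE (modulus u) := by
  obtain ⟨_, hPQ, _, hR, rfl⟩ := Submodule.mem_sup.1 hf
  obtain ⟨_, hP, _, hQ, rfl⟩ := Submodule.mem_sup.1 hPQ
  obtain ⟨P, hPdeg, rfl⟩ := mem_polyMultiples.1 hP
  obtain ⟨Q, hQdeg, rfl⟩ := mem_polyMultiples.1 hQ
  obtain ⟨R, hRdeg, rfl⟩ := mem_polyMultiples.1 hR
  refine ⟨P, Q, R, hPdeg, hQdeg, hRdeg, fun u => ?_⟩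
  simp only [Pi.add_apply, Pi.mul_apply, Pi.pow_apply, aeval_fn_apply, coe_aeval_eq_eval, uFun,
    ellipticKFun, ellipticEFun]
  ring

theorem exists_polynomials_abelianIntegral {n : ℕ} (hn : 3 ≤ n) (a : ℕ → ℝ) :
    ∃ P Q R : ℝ[X], P.natDegree ≤ 2 * ((n - 2) / 2) + 2 ∧
      Q.natDegree ≤ 4 * ((n - 3) / 2) + 6 + (n + 1) % 2 ∧
      R.natDegree ≤ 2 * ((n - 3) / 2) + 2 ∧
      ∀ h : ℝ, 0 < h → ∀ (γ : ℝ → ℝ × ℝ) (T : ℝ), IsOrbitParam h γ T →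
        abelianIntegral n a γ T = 1 / uVar h ^ n * (uVar h ^ (n % 2) * P.eval (uVar h ^ 2) +
          Q.eval (uVar h) * ellipticK (modulus (uVar h)) +
          uVar h ^ ((n + 1) % 2) * R.eval (uVar h ^ 2) * ellipticE (modulus (uVar h))) := by
  have hmem : (1 / 2 : ℝ) • ∑ i ∈ Finset.range (n + 1), a i • (fun u : Set.Ioo (0 : ℝ) 1 =>
      (u : ℝ) ^ n * lineIntegral (orbit u) (2 * π) i 1) ∈ ellipticForms n :=
    Submodule.smul_mem _ _ <| Submodule.sum_mem _ fun i hi => Submodule.smul_mem _ _ <|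
      pow_mul_lineIntegral_orbit_mem hn (Finset.mem_range_succ_iff.1 hi)
  obtain ⟨P, Q, R, hP, hQ, hR, hform⟩ := exists_polynomials_of_mem_ellipticForms hmem
  refine ⟨P, Q, R, hP, hQ, hR, fun h hh γ T H => ?_⟩
  have hu := uVar_mem_Ioo hh
  have hu0 := hu.1.ne'
  rw [← level_uVar hh] at H
  rw [← hform ⟨uVar h, hu⟩, abelianIntegral]
  simp only [Pi.smul_apply, Finset.sum_apply, smul_eq_mul, H.lineIntegral_eq hu,
    Finset.mul_sum]
  refine Finset.sum_congr rfl fun i _ => ?_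
  field_simp

end CubicReversible

open CubicReversible in
theorem proposition2p1 (n : ℕ) (hn : 3 ≤ n) (a : ℕ → ℝ) :
    Set.BijOn uVar (Set.Ioi 0) (Set.Ioo 0 1) ∧
    (∀ h : ℝ, 0 < h → ∃ (γ : ℝ → ℝ × ℝ) (T : ℝ), IsOrbitParam h γ T) ∧
    (Odd n → ∃ P Q R : Polynomial ℝ,
      P.natDegree ≤ 2 * ((n - 2) / 2) + 2 ∧
      Q.natDegree ≤ 4 * ((n - 3) / 2) + 6 ∧
      R.natDegree ≤ 2 * ((n - 3) / 2) + 2 ∧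
      ∀ h : ℝ, 0 < h → ∀ (γ : ℝ → ℝ × ℝ) (T : ℝ), IsOrbitParam h γ T →
        abelianIntegral n a γ T =
          1 / uVar h ^ (2 * ((n - 3) / 2) + 3) *
            (uVar h * P.eval (uVar h ^ 2)
              + Q.eval (uVar h) * ellipticK (modulus (uVar h))
              + R.eval (uVar h ^ 2) * ellipticE (modulus (uVar h)))) ∧
    (Even n → ∃ P Q R : Polynomial ℝ,
      P.natDegree ≤ 2 * ((n - 2) / 2) + 2 ∧
      Q.natDegree ≤ 4 * ((n - 3) / 2) + 7 ∧
      R.natDegree ≤ 2 * ((n - 3) / 2) + 2 ∧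
      ∀ h : ℝ, 0 < h → ∀ (γ : ℝ → ℝ × ℝ) (T : ℝ), IsOrbitParam h γ T →
        abelianIntegral n a γ T =
          1 / uVar h ^ (2 * ((n - 2) / 2) + 2) *
            (P.eval (uVar h ^ 2)
              + Q.eval (uVar h) * ellipticK (modulus (uVar h))
              + uVar h * R.eval (uVar h ^ 2) * ellipticE (modulus (uVar h)))) := by
  obtain ⟨P, Q, R, hP, hQ, hR, hform⟩ := exists_polynomials_abelianIntegral hn a
  refine ⟨bijOn_uVar, fun h hh => ⟨orbit (uVar h), 2 * Real.pi, ?_⟩, fun hodd => ?_,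
    fun heven => ?_⟩
  · simpa only [level_uVar hh] using isOrbitParam_orbit (uVar_mem_Ioo hh)
  · have hmod : n % 2 = 1 ∧ (n + 1) % 2 = 0 := by grind
    have hexp : 2 * ((n - 3) / 2) + 3 = n := by omega
    simp only [hmod, pow_one, pow_zero, one_mul] at hQ hform
    rw [hexp]
    exact ⟨P, Q, R, hP, hQ, hR, hform⟩
  · have hmod : n % 2 = 0 ∧ (n + 1) % 2 = 1 := by grind
    have hexp : 2 * ((n - 2) / 2) + 2 = n := by omega
    simp only [hmod, pow_one, pow_zero, one_mul] at hQ hform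
    rw [hexp] at hP ⊢
    exact ⟨P, Q, R, hP, hQ, hR, hform⟩
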